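/- Let $a>0$, $c>0$, $\rho\in[-1,1]$ and $t>0$ be real numbers, and assume that it is not the case that both $\rho=1$ and $c=2a$. Put $p(z)=(a-\rho c z)^2+c^2(z-z^2)$, and let $L_1(w)=\sum_{n\ge 0} w^n/(2n)!$ and $L_2(w)=\sum_{n\ge 0} w^n/(2n+1)!$, so that $L_1(w)=\cosh\sqrt w$ and $L_2(w)=\sinh(\sqrt w)/\sqrt w$ for either branch of the square root. Let $F$ be the entire function $$F(z)=L_1\!\Big(\frac{p(z)t^2}{4}\Big)+(a-c\rho z)\,\frac t2\,L_2\!\Big(\frac{p(z)t^2}{4}\Big),$$ that is, $F(z)=\cosh(P(z)t/2)+(a-c\rho z)\,\dfrac{\sinh(P(z)t/2)}{P(z)}$ with $P(z)=\sqrt{p(z)}$. Then all zeros of $F$ in $\mathbb C$ are real and simple, and they form a countably infinite set. Moreover there is a real number $\nu(t)$ (depending only on $a,c,\rho,t$) such that for every enumeration $(a_n)_{n\ge1}$ of the zeros of $F$, each listed once, one has $\sum_n 1/a_n^2<\infty$, and for every $z\in\mathbb C$ $$F(z)=e^{at/2}\,e^{\nu(t) z}\prod_{n=1}^\infty\Big(1-\frac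 z{a_n}\Big)e^{z/a_n},$$ where the product converges unconditionally. -/

import Mathlib

namespace Heston

noncomputable section

/-- The entire function `L₁(w) = ∑ wⁿ / (2n)!`, i.e. `cosh √w` for either branch of the root. -/
def L₁ (w : ℂ) : ℂ := ∑' n : ℕ, w ^ n / ((2 * n).factorial : ℂ)

/-- The entire function `L₂(w) = ∑ wⁿ / (2n+1)!`, i.e. `sinh √w / √w` for either branch. -/
def L₂ (w : ℂ) : ℂ := ∑' n : ℕ, w ^ n / ((2 * n + 1).factorial : ℂ)

/-- The polynomial `p(z) = (a - ρ c z)² + c² (z - z²)`. -/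
def p (a c ρ : ℝ) (z : ℂ) : ℂ := (a - ρ * c * z) ^ 2 + c ^ 2 * (z - z ^ 2)

/-- The entire function
`F(z) = cosh (P(z) t / 2) + (a - c ρ z) sinh (P(z) t / 2) / P(z)`, with `P(z) = √p(z)`,
extended to the whole plane (in particular to the zeros of `p`) by means of `L₁` and `L₂`:
`cosh (P t / 2) = L₁ (p t² / 4)` and `sinh (P t / 2) / P = (t / 2) L₂ (p t² / 4)`. -/
def F (a c ρ t : ℝ) (z : ℂ) : ℂ :=
  L₁ (p a c ρ z * t ^ 2 / 4) + (a - c * ρ * z) * ((t / 2) * L₂ (p a c ρ z * t ^ 2 / 4))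

theorem L₁_sq (w : ℂ) : L₁ (w ^ 2) = Complex.cosh w := by
  rw [Complex.cosh_eq_tsum, L₁]
  simp only [pow_mul]

theorem mul_L₂_sq (w : ℂ) : w * L₂ (w ^ 2) = Complex.sinh w := by
  rw [Complex.sinh_eq_tsum, L₂, ← tsum_mul_left]
  refine tsum_congr fun n => ?_
  rw [← pow_mul]
  ring

/-- `F` agrees with the closed formula for any nonzero square root `P` of `p(z)`. -/
theorem F_eq (a c ρ t : ℝ) (z P : ℂ) (hP : P ^ 2 = p a c ρ z) (hP0 : P ≠ 0) :
    F a c ρ t z = Complex.cosh (P * t / 2) +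
      (a - c * ρ * z) * (Complex.sinh (P * t / 2) / P) := by
  have h : p a c ρ z * t ^ 2 / 4 = (P * t / 2) ^ 2 := by rw [← hP]; ring
  rw [F, h, L₁_sq, ← mul_L₂_sq (P * t / 2)]
  field_simp

end

end Heston

namespace Heston

open Complex Metric Filter Topology ComplexConjugate

/-! For fixed `z`, `y(s) = F a c ρ s z` solves `y'' = (p(z)/4) y`, `y(0) = 1`, `y'(0) = (a -
cρz)/2`; `flux` is `y'`. A zero of `F a c ρ t` is thus an eigenvalue of a boundary problem with
`y(t) = 0`. Integrating `(conj y) y'` by parts gives `D + (p(z)/4) Y + (a - cρz)/2 = 0`, where `D =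
∫|y'|²` and `Y = ∫|y|²`. With `D`, `Y` frozen this is a real polynomial of degree at most two,
positive at `0` and with nonpositive leading coefficient, so its roots are real and simple. The
Wronskian identity identifies its slope at the zero, up to sign, with `flux` times the derivative of
`F`, so the zero of `F` is simple.

There are infinitely many zeros: `p` tends to `-∞` in some real direction, and `F = ±1` alternately
where `√p t/2 = kπi`.

The product is Hadamard's theorem for exponential type: there are `O(R)` zeros in the disc of radius
`R`. Dividing them out leaves a zero-free function there of size `exp O(R)`, whose logarithm is
linear up to `O(|z|²/R)` by Borel–Carathéodory. Hence `ν` is the logarithmic derivative of `F` at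
`0`. -/

/-! ### Division by zeros and logarithms of zero-free functions -/

/-- A finite set of nonzero zeros of an entire function can be divided out. -/
theorem exists_eq_mul_prod_one_sub_div {f : ℂ → ℂ} (hf : Differentiable ℂ f) (S : Finset ℂ)
    (hS : ∀ a ∈ S, f a = 0) (hS0 : ∀ a ∈ S, a ≠ 0) :
    ∃ h : ℂ → ℂ, Differentiable ℂ h ∧ ∀ z, f z = h z * ∏ a ∈ S, (1 - z / a) := by
  classical
  induction S using Finset.induction_on with
  | empty => exact ⟨f, hf, by simp⟩
  | insert a S ha ih =>
    obtain ⟨h, hh, hfh⟩ := ih (fun b hb => hS b (Finset.mem_insert_of_mem hb))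
      (fun b hb => hS0 b (Finset.mem_insert_of_mem hb))
    have ha0 : a ≠ 0 := hS0 a (Finset.mem_insert_self a S)
    have hha : h a = 0 := by
      have h1 := hfh a
      rw [hS a (Finset.mem_insert_self a S)] at h1
      refine (mul_eq_zero.mp h1.symm).resolve_right (Finset.prod_ne_zero_iff.mpr fun b hb h2 => ?_)
      have hb0 : b ≠ 0 := hS0 b (Finset.mem_insert_of_mem hb)
      have : a = b := by field_simp at h2; linear_combination -h2
      exact ha (this ▸ hb)
    -- `h z = (z - a) * dslope h a z`, and `z - a = -a * (1 - z / a)`.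
    refine ⟨fun z => -a * dslope h a z, ?_, fun z => ?_⟩
    · refine Differentiable.const_mul ?_ _
      rw [← differentiableOn_univ, Complex.differentiableOn_dslope univ_mem]
      exact hh.differentiableOn
    · have h3 := sub_smul_dslope h a z
      rw [hha, smul_eq_mul, sub_zero] at h3
      rw [hfh z, Finset.prod_insert ha, ← h3]
      field_simp
      ring

/-- The quotient of an entire function by finitely many of its zeros in a disc, estimated by the
maximum principle on the disc of three times the radius. -/
theorem norm_mul_two_pow_card_le {f h : ℂ → ℂ} (hh : Differentiable ℂ h) (S : Finset ℂ)
    (hS0 : ∀ a ∈ S, a ≠ 0) (hfh : ∀ z, f z = h z * ∏ a ∈ S, (1 - z / a)) {R B : ℝ} (hR : 0 < R)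
    (hSR : ∀ a ∈ S, ‖a‖ ≤ R) (hB : ∀ z, ‖z‖ = 3 * R → ‖f z‖ ≤ B) {z : ℂ} (hz : ‖z‖ ≤ 3 * R) :
    ‖h z‖ * 2 ^ S.card ≤ B := by
  have key : ‖h z‖ ≤ B / 2 ^ S.card := by
    refine norm_le_of_forall_mem_frontier_norm_le (U := ball (0 : ℂ) (3 * R)) isBounded_ball
      hh.diffContOnCl (fun w hw => ?_) ?_
    · rw [frontier_ball _ (by positivity), mem_sphere_zero_iff_norm] at hw
      rw [le_div_iff₀ (by positivity)]
      refine le_trans ?_ (hB w hw)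
      rw [hfh w, norm_mul, norm_prod]
      gcongr
      rw [← Finset.prod_const]
      refine Finset.prod_le_prod (fun _ _ => by norm_num) fun a ha => ?_
      have ha' : 0 < ‖a‖ := norm_pos_iff.mpr (hS0 a ha)
      -- The radius `3R` makes every factor `1 - w / a` at least `3 - 1 = 2` in modulus.
      have h1 : 3 ≤ ‖w / a‖ := by
        rw [norm_div, hw, le_div_iff₀ ha']
        linarith [hSR a ha]
      have h2 := norm_sub_norm_le (w / a) 1
      rw [norm_sub_rev, norm_one] at h2
      linarith
    · rw [closure_ball _ (by positivity)]
      simpa using hz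
  rwa [le_div_iff₀ (by positivity)] at key

/-- A holomorphic zero-free function on a disc is, up to a quadratically small exponent, the
exponential of its linearized logarithm. -/
theorem exists_eq_exp_of_ne_zero {G : ℂ → ℂ} {R M : ℝ} (hR : 0 < R) (hM : 0 < M)
    (hG : DifferentiableOn ℂ G (ball 0 R)) (h0 : ∀ z ∈ ball (0 : ℂ) R, G z ≠ 0)
    (hGM : ∀ z ∈ ball (0 : ℂ) R, ‖G z‖ ≤ ‖G 0‖ * Real.exp M) {z : ℂ} (hz : ‖z‖ < R / 2) :
    ∃ k : ℂ, G z = G 0 * exp (logDeriv G 0 * z + k) ∧ ‖k‖ ≤ 16 * M * ‖z‖ ^ 2 / R ^ 2 := by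
  have h00 : (0 : ℂ) ∈ ball (0 : ℂ) R := mem_ball_self hR
  obtain ⟨g₀, hg₀⟩ := (DifferentiableOn.div (hG.deriv isOpen_ball) hG h0).isExactOn_ball
  set g : ℂ → ℂ := fun w => g₀ w - g₀ 0 with hgdef
  have hg : ∀ w ∈ ball (0 : ℂ) R, HasDerivAt g (deriv G w / G w) w :=
    fun w hw => (hg₀ w hw).sub_const _
  have hg0 : g 0 = 0 := by simp [hgdef]
  have hGd : ∀ w ∈ ball (0 : ℂ) R, HasDerivAt G (deriv G w) w := fun w hw =>
    ((hG w hw).differentiableAt (isOpen_ball.mem_nhds hw)).hasDerivAt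
  have hconst : ∀ w ∈ ball (0 : ℂ) R, G w = G 0 * exp (g w) := by
    intro w hw
    have hd : ∀ x ∈ ball (0 : ℂ) R, HasDerivAt (fun x => G x * exp (-g x)) 0 x := by
      intro x hx
      have hGx := h0 x hx
      refine ((hGd x hx).mul (hg x hx).neg.cexp).congr_deriv ?_
      field_simp
      ring
    have h1 := (convex_ball (0 : ℂ) R).is_const_of_fderivWithin_eq_zero (𝕜 := ℂ)
      (f := fun x => G x * exp (-g x))
      (fun x hx => (hd x hx).differentiableAt.differentiableWithinAt)
      (fun x hx => by
        rw [fderivWithin_of_isOpen isOpen_ball hx]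
        ext
        simp [(hd x hx).deriv]) hw h00
    simp only [hg0, neg_zero, exp_zero, mul_one] at h1
    rw [← h1, mul_assoc, ← exp_add]
    simp
  have hgdiff : DifferentiableOn ℂ g (ball 0 R) :=
    fun w hw => (hg w hw).differentiableAt.differentiableWithinAt
  have hre : Set.MapsTo g (ball 0 R) {z | z.re ≤ M} := by
    intro w hw
    have h1 := hGM w hw
    rw [hconst w hw, norm_mul, norm_exp] at h1
    exact Real.exp_le_exp.mp (le_of_mul_le_mul_left h1 (norm_pos_iff.mpr (h0 0 h00)))
  have hsub : ball (0 : ℂ) (R / 2) ⊆ ball 0 R := ball_subset_ball (by linarith)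
  have hbd : ∀ w ∈ ball (0 : ℂ) (R / 2), ‖g w‖ ≤ 2 * M := by
    intro w hw
    have h1 := borelCaratheodory_zero hM hgdiff hre hR (hsub hw) hg0
    rw [mem_ball_zero_iff] at hw
    refine h1.trans ?_
    rw [div_le_iff₀ (by linarith)]
    nlinarith [norm_nonneg w]
  have hd0 : ‖logDeriv G 0‖ ≤ 2 * M / (R / 2) := by
    have h1 := norm_deriv_le_div_of_mapsTo_ball (f := g) (c := 0) (R₁ := R / 2) (R₂ := 2 * M)
      (hgdiff.mono hsub) (fun w hw => by simpa [hg0] using hbd w hw) (by positivity)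
    rwa [(hg 0 h00).deriv] at h1
  refine ⟨g z - logDeriv G 0 * z, ?_, ?_⟩
  · rw [add_sub_cancel, ← hconst z (hsub (by simpa using hz))]
  · set k : ℂ → ℂ := fun w => g w - logDeriv G 0 * w with hk
    have hk0 : k 0 = 0 := by simp [hk, hg0]
    have hkd : HasDerivAt k 0 0 := by
      refine ((hg 0 h00).sub ((hasDerivAt_id (0 : ℂ)).const_mul (logDeriv G 0))).congr_deriv ?_
      simp [logDeriv]
    have hkb : Set.MapsTo k (ball 0 (R / 2)) (closedBall (k 0) (4 * M)) := by
      intro w hw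
      rw [hk0, mem_closedBall_zero_iff]
      have h1 := hbd w hw
      rw [mem_ball_zero_iff] at hw
      calc ‖k w‖ ≤ ‖g w‖ + ‖logDeriv G 0 * w‖ := norm_sub_le _ _
        _ ≤ 2 * M + 2 * M / (R / 2) * (R / 2) := by
          rw [norm_mul]
          gcongr
        _ = 4 * M := by field_simp; ring
    -- Schwarz lemma for a zero of order two: `4M (‖z‖ / (R/2))²` is the claimed `16 M ‖z‖² / R²`.
    have h2 := dist_le_mul_div_pow_of_mapsTo_ball_of_isLittleO (n := 1) (f := k) (c := 0) (z := z)
      (R₁ := R / 2) (R₂ := 4 * M) ((hgdiff.mono hsub).sub (by fun_prop)) hkb ?_ (by simpa using hz)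
    · rw [hk0, dist_zero_right, dist_zero_right] at h2
      refine h2.trans_eq ?_
      rw [one_add_one_eq_two, div_pow, div_pow]
      field_simp
      ring
    · have h3 := hkd.isLittleO
      simp only [sub_zero, smul_zero] at h3
      simpa [hk0] using h3.norm_right
-- Counting zeros and convergence of the canonical product
/-- An entire function of exponential type has at most linearly many zeros in discs. -/
theorem card_zeros_le {f : ℂ → ℂ} (hf : Differentiable ℂ f) (hf0 : f 0 ≠ 0) {C : ℝ}
    (hfC : ∀ z, ‖f z‖ ≤ Real.exp (C * (1 + ‖z‖))) {R : ℝ} (hR : 0 < R) (S : Finset ℂ)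
    (hS : ∀ a ∈ S, f a = 0 ∧ ‖a‖ ≤ R) :
    (S.card : ℝ) * Real.log 2 ≤ C * (1 + 3 * R) - Real.log ‖f 0‖ := by
  have hS0 : ∀ a ∈ S, a ≠ 0 := fun a ha h => hf0 (h ▸ (hS a ha).1)
  obtain ⟨h, hh, hfh⟩ := exists_eq_mul_prod_one_sub_div hf S (fun a ha => (hS a ha).1) hS0
  have h1 := norm_mul_two_pow_card_le hh S hS0 hfh hR (fun a ha => (hS a ha).2)
    (B := Real.exp (C * (1 + 3 * R))) (fun z hz => hz ▸ hfC z) (z := 0) (by simp; positivity)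
  have h2 : f 0 = h 0 := by simpa using hfh 0
  rw [← h2] at h1
  have h3 := Real.log_le_log (by positivity) h1
  rw [Real.log_mul (by positivity) (by positivity), Real.log_exp, Real.log_pow] at h3
  linarith

theorem finite_zeros_norm_le {f : ℂ → ℂ} (hf : Differentiable ℂ f) (hf0 : f 0 ≠ 0) {C : ℝ}
    (hfC : ∀ z, ‖f z‖ ≤ Real.exp (C * (1 + ‖z‖))) {R : ℝ} (hR : 0 < R) :
    {z : ℂ | f z = 0 ∧ ‖z‖ ≤ R}.Finite := by
  by_contra hinf
  obtain ⟨n, hn⟩ := exists_nat_gt ((C * (1 + 3 * R) - Real.log ‖f 0‖) / Real.log 2)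
  obtain ⟨S, hS, hcard⟩ := Set.Infinite.exists_subset_card_eq hinf n
  have h1 := card_zeros_le hf hf0 hfC hR S (fun a ha => hS ha)
  rw [div_lt_iff₀ (Real.log_pos one_lt_two), ← hcard] at hn
  linarith

/-- Linear growth of the counting function makes the inverse squares summable. -/
theorem summable_one_div_sq_of_card_le {r : ℕ → ℝ} {K : ℝ} (hr : ∀ n, 0 < r n)
    (hK : ∀ (T : Finset ℕ) (m : ℕ), (∀ n ∈ T, r n ≤ r m) → (T.card : ℝ) ≤ K * r m) :
    Summable fun n => 1 / r n ^ 2 := by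
  have hfin : ∀ T : Finset ℕ,
      ∑ n ∈ T, 1 / r n ^ 2 ≤ ∑ j ∈ Finset.range T.card, K ^ 2 * (1 / ((j : ℝ) + 1) ^ 2) := by
    intro T
    -- Adding elements by increasing `r`, the `(j+1)`-st satisfies `j + 1 ≤ K r`.
    induction T using Finset.induction_on_max_value r with
    | empty => simp
    | insert m T hm hmax ih =>
      rw [Finset.sum_insert hm, Finset.card_insert_of_notMem hm, Finset.sum_range_succ, add_comm]
      refine add_le_add ih ?_
      have h1 := hK (insert m T) m (by
        intro n hn
        rcases Finset.mem_insert.mp hn with rfl | h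
        · exact le_rfl
        · exact hmax n h)
      rw [Finset.card_insert_of_notMem hm] at h1
      push_cast at h1
      have h2 : ((T.card : ℝ) + 1) ^ 2 ≤ (K * r m) ^ 2 := by gcongr
      have h3 := hr m
      rw [← mul_div_assoc, mul_one, div_le_div_iff₀ (by positivity) (by positivity)]
      rw [mul_pow] at h2
      linarith
  have hs : Summable fun j : ℕ => K ^ 2 * (1 / ((j : ℝ) + 1) ^ 2) := by
    refine Summable.mul_left _ ?_
    have h1 := (summable_nat_add_iff 1).mpr
      (Real.summable_one_div_nat_pow.mpr (one_lt_two : 1 < 2))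
    simpa using h1
  exact summable_of_sum_le (fun n => by positivity) fun T => (hfin T).trans
    (hs.sum_le_tsum _ fun j _ => by positivity)

theorem norm_one_sub_mul_exp_sub_one_le {u : ℂ} (hu : ‖u‖ ≤ 1) :
    ‖(1 - u) * exp u - 1‖ ≤ 3 * ‖u‖ ^ 2 := by
  have h1 := norm_exp_sub_one_sub_id_le hu
  have h2 := norm_exp_sub_one_le hu
  calc ‖(1 - u) * exp u - 1‖ = ‖(exp u - 1 - u) - u * (exp u - 1)‖ := by congr 1; ring
    _ ≤ ‖u‖ ^ 2 + ‖u‖ * (2 * ‖u‖) := by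
      refine (norm_sub_le _ _).trans (add_le_add h1 ?_)
      rw [norm_mul]
      gcongr
    _ = 3 * ‖u‖ ^ 2 := by ring

theorem multipliable_one_sub_mul_exp {α : ℕ → ℂ} (hα : Summable fun n => 1 / ‖α n‖ ^ 2) (z : ℂ) :
    Multipliable fun n => (1 - z / α n) * exp (z / α n) := by
  have hs : Summable fun n => ‖z / α n‖ ^ 2 := by
    refine (hα.mul_left (‖z‖ ^ 2)).congr fun n => ?_
    rw [norm_div]
    ring
  have h1 : Summable fun n => (1 - z / α n) * exp (z / α n) - 1 := by
    refine Summable.of_norm_bounded_eventually (hs.mul_left 3) ?_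
    filter_upwards [hs.tendsto_cofinite_zero.eventually_le_const one_pos] with n hn
    exact norm_one_sub_mul_exp_sub_one_le (by nlinarith [norm_nonneg (z / α n)])
  simpa using Complex.multipliable_one_add_of_summable h1

/-! ### Hadamard factorization -/

section Hadamard

variable {f : ℂ → ℂ} {C : ℝ} {α : ℕ → ℂ}

theorem summable_one_div_norm_zeros_sq (hf : Differentiable ℂ f) (hf0 : f 0 ≠ 0) (hC : 0 ≤ C)
    (hfC : ∀ z, ‖f z‖ ≤ Real.exp (C * (1 + ‖z‖))) (hα : Function.Injective α)
    (hz : ∀ n, f (α n) = 0) : Summable fun n => 1 / ‖α n‖ ^ 2 := by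
  have hα0 : ∀ n, α n ≠ 0 := fun n h => hf0 (h ▸ hz n)
  obtain ⟨r, hr, hrf⟩ := Metric.eventually_nhds_iff.mp (hf.continuous.continuousAt.eventually_ne hf0)
  have hrα : ∀ n, r ≤ ‖α n‖ := by
    intro n
    by_contra! h
    exact hrf (by simpa using h) (hz n)
  set A : ℝ := C + |Real.log ‖f 0‖| with hA
  have hA0 : 0 ≤ A := by positivity
  have hl : 0 < Real.log 2 := Real.log_pos one_lt_two
  refine summable_one_div_sq_of_card_le (K := (A / r + 3 * C) / Real.log 2)
    (fun n => norm_pos_iff.mpr (hα0 n)) fun T m hT => ?_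
  have h1 := card_zeros_le hf hf0 hfC (norm_pos_iff.mpr (hα0 m)) (T.map ⟨α, hα⟩) (by
    intro a ha
    obtain ⟨n, hn, rfl⟩ := Finset.mem_map.mp ha
    exact ⟨hz n, hT n hn⟩)
  rw [Finset.card_map] at h1
  rw [div_mul_eq_mul_div, le_div_iff₀ hl, add_mul]
  -- The zero-free disc of radius `r` turns the affine zero count into a linear one.
  have h2 : A ≤ A / r * ‖α m‖ := by
    rw [div_mul_eq_mul_div, le_div_iff₀ hr]
    gcongr
    exact hrα m
  have h3 := neg_abs_le (Real.log ‖f 0‖)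
  linarith

/-- Hadamard's factorization for a disc: all zeros in the disc are divided out, and the error in
the exponent is `O(1/R)`. -/
theorem exists_eq_exp_mul_prod (hf : Differentiable ℂ f) (hf0 : f 0 ≠ 0) (hC : 0 ≤ C)
    (hfC : ∀ z, ‖f z‖ ≤ Real.exp (C * (1 + ‖z‖))) {R : ℝ} (hR : 0 < R) (S : Finset ℂ)
    (hS : ∀ a, a ∈ S ↔ f a = 0 ∧ ‖a‖ ≤ R) (hsimple : ∀ a ∈ S, deriv f a ≠ 0) {z : ℂ}
    (hz : ‖z‖ < R / 2) :
    ∃ k : ℂ, f z = f 0 * exp (logDeriv f 0 * z + k) * ∏ a ∈ S, (1 - z / a) * exp (z / a) ∧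
      ‖k‖ ≤ 16 * (C * (1 + 3 * R) + |Real.log ‖f 0‖| + 1) * ‖z‖ ^ 2 / R ^ 2 := by
  have hS0 : ∀ a ∈ S, a ≠ 0 := fun a ha h => hf0 (h ▸ ((hS a).mp ha).1)
  obtain ⟨h, hh, hfh⟩ := exists_eq_mul_prod_one_sub_div hf S (fun a ha => ((hS a).mp ha).1) hS0
  have hdprod : Differentiable ℂ fun z : ℂ => ∏ a ∈ S, (1 - z / a) := by fun_prop
  have hf0h : f 0 = h 0 := by simpa using hfh 0
  have hh0 : h 0 ≠ 0 := hf0h ▸ hf0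
  have hne : ∀ w ∈ ball (0 : ℂ) R, h w ≠ 0 := by
    intro w hw hw0
    have hfw : f w = 0 := by rw [hfh, hw0, zero_mul]
    have hwS : w ∈ S := (hS w).mpr ⟨hfw, (mem_ball_zero_iff.mp hw).le⟩
    -- Otherwise both `h` and the product vanish at `w`, and `f` has a multiple zero there.
    refine hsimple w hwS ?_
    have hprod : ∏ a ∈ S, (1 - w / a) = 0 :=
      Finset.prod_eq_zero hwS (by rw [div_self (hS0 w hwS), sub_self])
    have h1 := (hh w).hasDerivAt.mul (hdprod w).hasDerivAt
    rw [hw0, hprod, mul_zero, zero_mul, add_zero] at h1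
    rw [funext hfh]
    exact h1.deriv
  have hbd : ∀ w ∈ ball (0 : ℂ) R,
      ‖h w‖ ≤ ‖h 0‖ * Real.exp (C * (1 + 3 * R) + |Real.log ‖f 0‖| + 1) := by
    intro w hw
    have h1 := norm_mul_two_pow_card_le hh S hS0 hfh hR (fun a ha => ((hS a).mp ha).2)
      (B := Real.exp (C * (1 + 3 * R))) (fun z hz => hz ▸ hfC z) (z := w)
      (by linarith [mem_ball_zero_iff.mp hw])
    have h2 : (1 : ℝ) ≤ 2 ^ S.card := one_le_pow₀ one_le_two
    rw [← hf0h]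
    calc ‖h w‖ ≤ ‖h w‖ * 2 ^ S.card := le_mul_of_one_le_right (norm_nonneg _) h2
      _ ≤ Real.exp (C * (1 + 3 * R)) := h1
      _ ≤ Real.exp (Real.log ‖f 0‖ + (C * (1 + 3 * R) + |Real.log ‖f 0‖| + 1)) := by
        gcongr
        linarith [neg_abs_le (Real.log ‖f 0‖)]
      _ = _ := by rw [Real.exp_add, Real.exp_log (norm_pos_iff.mpr hf0)]
  obtain ⟨k, hk, hkb⟩ := exists_eq_exp_of_ne_zero hR
    (by positivity : 0 < C * (1 + 3 * R) + |Real.log ‖f 0‖| + 1)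
    hh.differentiableOn hne hbd hz
  refine ⟨k, ?_, hkb⟩
  -- Each factor `1 - z / a` contributes `-1/a`, which the convergence factor `exp (z / a)`
  -- compensates.
  have hlog : logDeriv f 0 = logDeriv h 0 - ∑ a ∈ S, 1 / a := by
    rw [funext hfh, logDeriv_mul 0 hh0 (by simp) (hh 0) (hdprod 0),
      logDeriv_prod (by simp) (by fun_prop), sub_eq_add_neg, ← Finset.sum_neg_distrib]
    congr 1
    refine Finset.sum_congr rfl fun a _ => ?_
    have h1 : HasDerivAt (fun z : ℂ => 1 - z / a) (-(1 / a)) 0 :=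
      ((hasDerivAt_id (0 : ℂ)).div_const a).const_sub 1
    simp [logDeriv]
  rw [hfh z, hk, hf0h, Finset.prod_mul_distrib, ← exp_sum, hlog]
  have h2 : exp (logDeriv h 0 * z + k) =
      exp ((logDeriv h 0 - ∑ a ∈ S, 1 / a) * z + k) * exp (∑ a ∈ S, z / a) := by
    rw [← exp_add]
    congr 1
    simp only [div_eq_mul_inv z, ← Finset.mul_sum, one_div]
    ring
  rw [h2]
  ring

/-- Hadamard's factorization theorem for entire functions of exponential type, not vanishing at the
origin, with infinitely many zeros, all of them simple. -/
theorem eq_exp_mul_tprod (hf : Differentiable ℂ f) (hf0 : f 0 ≠ 0) (hC : 0 ≤ C)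
    (hfC : ∀ z, ‖f z‖ ≤ Real.exp (C * (1 + ‖z‖))) (hsimple : ∀ z, f z = 0 → deriv f z ≠ 0)
    (hα : Function.Injective α) (hrange : Set.range α = {z | f z = 0}) (z : ℂ) :
    f z = f 0 * exp (logDeriv f 0 * z) * ∏' n, (1 - z / α n) * exp (z / α n) := by
  have hz : ∀ n, f (α n) = 0 := fun n => by
    have : α n ∈ {z | f z = 0} := hrange ▸ Set.mem_range_self n
    exact this
  have hfin : ∀ N : ℕ, {n | ‖α n‖ ≤ (N : ℝ) + 1}.Finite := by
    intro N
    have h1 := finite_zeros_norm_le hf hf0 hfC (R := (N : ℝ) + 1) (by positivity)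
    refine (h1.preimage hα.injOn).subset fun n hn => ⟨hz n, hn⟩
  set T : ℕ → Finset ℕ := fun N => (hfin N).toFinset with hT
  have hTmem : ∀ N n, n ∈ T N ↔ ‖α n‖ ≤ (N : ℝ) + 1 := fun N n => by simp [hT]
  have hTtop : Tendsto T atTop atTop := by
    refine tendsto_atTop_finset_of_monotone (fun M N hMN n hn => ?_) fun n => ?_
    · rw [hTmem] at hn ⊢
      have : (M : ℝ) ≤ N := by exact_mod_cast hMN
      linarith
    · obtain ⟨N, hN⟩ := exists_nat_ge ‖α n‖
      exact ⟨N, (hTmem N n).mpr (by linarith)⟩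
  have hprod := ((multipliable_one_sub_mul_exp
    (summable_one_div_norm_zeros_sq hf hf0 hC hfC hα hz) z).hasProd).comp hTtop
  have hex : ∀ N : ℕ, ∃ k : ℂ, 2 * ‖z‖ < (N : ℝ) + 1 →
      f z = f 0 * exp (logDeriv f 0 * z + k) * ∏ n ∈ T N, (1 - z / α n) * exp (z / α n) ∧
      ‖k‖ ≤ 16 * (C * (1 + 3 * ((N : ℝ) + 1)) + |Real.log ‖f 0‖| + 1) * ‖z‖ ^ 2 /
        ((N : ℝ) + 1) ^ 2 := by
    intro N
    by_cases hN : 2 * ‖z‖ < (N : ℝ) + 1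
    · obtain ⟨k, hk, hkb⟩ := exists_eq_exp_mul_prod hf hf0 hC hfC (R := (N : ℝ) + 1)
        (by positivity) ((T N).map ⟨α, hα⟩) (fun a => by
          simp only [Finset.mem_map, Function.Embedding.coeFn_mk, hTmem]
          constructor
          · rintro ⟨n, hn, rfl⟩
            exact ⟨hz n, hn⟩
          · rintro ⟨ha, haN⟩
            have : a ∈ Set.range α := hrange ▸ ha
            obtain ⟨n, rfl⟩ := this
            exact ⟨n, haN, rfl⟩) (fun a ha => by
          obtain ⟨n, hn, rfl⟩ := Finset.mem_map.mp ha
          exact hsimple _ (hz n)) (z := z) (by linarith)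
      exact ⟨k, fun _ => ⟨by rw [hk, Finset.prod_map]; rfl, hkb⟩⟩
    -- Junk value for the finitely many `N` whose disc is too small.
    · exact ⟨0, fun h => absurd h hN⟩
  choose k hk using hex
  have hev : ∀ᶠ N : ℕ in atTop, 2 * ‖z‖ < (N : ℝ) + 1 := by
    obtain ⟨N₀, hN₀⟩ := exists_nat_gt (2 * ‖z‖)
    filter_upwards [eventually_ge_atTop N₀] with N hN
    have : (N₀ : ℝ) ≤ N := by exact_mod_cast hN
    linarith
  have hk0 : Tendsto k atTop (𝓝 0) := by
    have hlim : Tendsto (fun N : ℕ => 1 / ((N : ℝ) + 1)) atTop (𝓝 0) :=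
      tendsto_one_div_add_atTop_nhds_zero_nat
    have h1 := (((hlim.pow 2).const_mul (C + |Real.log ‖f 0‖| + 1)).add
      (hlim.const_mul (3 * C))).const_mul (16 * ‖z‖ ^ 2)
    simp only [ne_eq, OfNat.ofNat_ne_zero, not_false_eq_true, zero_pow, mul_zero, add_zero] at h1
    refine squeeze_zero_norm' ?_ h1
    filter_upwards [hev] with N hN
    refine ((hk N hN).2).trans_eq ?_
    have : (N : ℝ) + 1 ≠ 0 := by positivity
    field_simp
    ring
  have hlim : Tendsto (fun N => f 0 * exp (logDeriv f 0 * z + k N) *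
      ∏ n ∈ T N, (1 - z / α n) * exp (z / α n)) atTop
      (𝓝 (f 0 * exp (logDeriv f 0 * z + 0) * ∏' n, (1 - z / α n) * exp (z / α n))) :=
    (((hk0.const_add _).cexp).const_mul _).mul hprod
  rw [add_zero] at hlim
  refine tendsto_nhds_unique (tendsto_const_nhds.congr' ?_) hlim
  filter_upwards [hev] with N hN
  exact (hk N hN).1

end Hadamard

/-! ### The series `L₁` and `L₂` -/

theorem norm_pow_div_factorial_le {φ : ℕ → ℕ} (hφ : ∀ n, 2 * n ≤ φ n) (n : ℕ) (w : ℂ) :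
    ‖w ^ n / ((φ n).factorial : ℂ)‖ ≤ ‖w‖ ^ n / ((2 * n).factorial : ℝ) := by
  rw [norm_div, norm_pow, norm_natCast]
  gcongr
  exact hφ n

theorem summable_pow_div_two_mul_factorial {r : ℝ} (hr : 0 ≤ r) :
    Summable fun n : ℕ => r ^ n / ((2 * n).factorial : ℝ) := by
  refine Summable.of_nonneg_of_le (fun n => by positivity) (fun n => ?_)
    (Real.summable_pow_div_factorial r)
  gcongr
  omega

theorem differentiable_tsum_pow_div_factorial {φ : ℕ → ℕ} (hφ : ∀ n, 2 * n ≤ φ n) :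
    Differentiable ℂ fun w : ℂ => ∑' n : ℕ, w ^ n / ((φ n).factorial : ℂ) := by
  intro w
  have h1 : DifferentiableOn ℂ (fun w : ℂ => ∑' n : ℕ, w ^ n / ((φ n).factorial : ℂ))
      (ball 0 (‖w‖ + 1)) := by
    refine differentiableOn_tsum_of_summable_norm
      (summable_pow_div_two_mul_factorial (r := ‖w‖ + 1) (by positivity)) (fun n => by fun_prop)
      isOpen_ball fun n v hv => (norm_pow_div_factorial_le hφ n v).trans ?_
    gcongr
    exact (mem_ball_zero_iff.mp hv).le
  exact h1.differentiableAt (isOpen_ball.mem_nhds (by simp))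

/-- Both series are dominated by that of `cosh r`. As `p` is quadratic, growth `exp √‖w‖` makes `F`
of exponential type. -/
theorem norm_tsum_pow_div_factorial_le {φ : ℕ → ℕ} (hφ : ∀ n, 2 * n ≤ φ n) {w : ℂ} {r : ℝ}
    (hr : 0 ≤ r) (hw : ‖w‖ ≤ r ^ 2) :
    ‖∑' n : ℕ, w ^ n / ((φ n).factorial : ℂ)‖ ≤ Real.exp r := by
  have hs := summable_pow_div_two_mul_factorial (r := r ^ 2) (by positivity)
  have h1 : ‖∑' n : ℕ, w ^ n / ((φ n).factorial : ℂ)‖ ≤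
      ∑' n : ℕ, (r ^ 2) ^ n / ((2 * n).factorial : ℝ) := by
    refine tsum_of_norm_bounded hs.hasSum fun n => (norm_pow_div_factorial_le hφ n w).trans ?_
    gcongr
  refine h1.trans ?_
  have h2 : ∑' n : ℕ, (r ^ 2) ^ n / ((2 * n).factorial : ℝ) = Real.cosh r := by
    rw [Real.cosh_eq_tsum]
    simp only [pow_mul]
  rw [h2, ← Real.cosh_add_sinh]
  linarith [Real.sinh_nonneg_iff.mpr hr]

theorem conj_tsum_pow_div_factorial (φ : ℕ → ℕ) (w : ℂ) :
    conj (∑' n : ℕ, w ^ n / ((φ n).factorial : ℂ)) =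
      ∑' n : ℕ, (conj w) ^ n / ((φ n).factorial : ℂ) := by
  rw [RCLike.conj_tsum]
  simp

theorem differentiable_L₁ : Differentiable ℂ L₁ :=
  differentiable_tsum_pow_div_factorial (φ := fun n => 2 * n) fun _ => le_rfl

theorem differentiable_L₂ : Differentiable ℂ L₂ :=
  differentiable_tsum_pow_div_factorial (φ := fun n => 2 * n + 1) fun _ => Nat.le_succ _

theorem conj_L₁ (w : ℂ) : conj (L₁ w) = L₁ (conj w) :=
  conj_tsum_pow_div_factorial (fun n => 2 * n) w

theorem conj_L₂ (w : ℂ) : conj (L₂ w) = L₂ (conj w) :=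
  conj_tsum_pow_div_factorial (fun n => 2 * n + 1) w

theorem L₁_zero : L₁ 0 = 1 := by simpa using L₁_sq 0

theorem L₂_zero : L₂ 0 = 1 := by
  rw [L₂, tsum_eq_single 0 (by intro n hn; simp [hn])]
  simp

@[fun_prop]
theorem continuous_L₁ : Continuous L₁ := differentiable_L₁.continuous

@[fun_prop]
theorem continuous_L₂ : Continuous L₂ := differentiable_L₂.continuous

/-- With `w = P²` the function is `cosh (P s / 2)`; writing the derivative through `L₂` avoids
dividing by `P`. -/
theorem hasDerivAt_L₁_mul_sq (w : ℂ) (s : ℝ) :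
    HasDerivAt (fun s : ℝ => L₁ (w * s ^ 2 / 4)) (w / 2 * (s / 2 * L₂ (w * s ^ 2 / 4))) s := by
  obtain ⟨P, rfl⟩ := IsAlgClosed.exists_pow_nat_eq w two_pos
  have harg : ∀ s : ℝ, P ^ 2 * (s : ℂ) ^ 2 / 4 = (P * s / 2) ^ 2 := fun s => by ring
  simp only [harg, L₁_sq]
  have h1 : HasDerivAt (fun s : ℂ => P * s / 2) (P / 2) s := by
    simpa using ((hasDerivAt_id (s : ℂ)).const_mul P).div_const 2
  refine h1.ccosh.comp_ofReal.congr_deriv ?_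
  rw [← mul_L₂_sq]
  ring

theorem hasDerivAt_mul_L₂_mul_sq (w : ℂ) (s : ℝ) :
    HasDerivAt (fun s : ℝ => (s : ℂ) / 2 * L₂ (w * s ^ 2 / 4)) (L₁ (w * s ^ 2 / 4) / 2) s := by
  obtain ⟨P, rfl⟩ := IsAlgClosed.exists_pow_nat_eq w two_pos
  rcases eq_or_ne P 0 with rfl | hP
  · have h1 : HasDerivAt (fun s : ℂ => s / 2) (1 / 2) s := (hasDerivAt_id (s : ℂ)).div_const 2
    simpa [L₁_zero, L₂_zero] using h1.comp_ofReal
  · have harg : ∀ s : ℝ, P ^ 2 * (s : ℂ) ^ 2 / 4 = (P * s / 2) ^ 2 := fun s => by ring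
    have hfun : ∀ s : ℝ, (s : ℂ) / 2 * L₂ ((P * s / 2) ^ 2) = sinh (P * s / 2) / P := fun s => by
      rw [← mul_L₂_sq]
      field_simp
    simp only [harg, L₁_sq, hfun]
    have h1 : HasDerivAt (fun s : ℂ => P * s / 2) (P / 2) s := by
      simpa using ((hasDerivAt_id (s : ℂ)).const_mul P).div_const 2
    refine (h1.csinh.comp_ofReal.div_const P).congr_deriv ?_
    field_simp

/-! ### The differential equation in time and its integral identities -/

/-- The derivative of `F` with respect to the time `t`. -/
noncomputable def flux (a c ρ t : ℝ) (z : ℂ) : ℂ :=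
  p a c ρ z / 2 * (t / 2 * L₂ (p a c ρ z * t ^ 2 / 4)) +
    (a - c * ρ * z) / 2 * L₁ (p a c ρ z * t ^ 2 / 4)

section

variable (a c ρ : ℝ)

theorem hasDerivAt_F (z : ℂ) (s : ℝ) :
    HasDerivAt (fun s : ℝ => F a c ρ s z) (flux a c ρ s z) s := by
  refine ((hasDerivAt_L₁_mul_sq (p a c ρ z) s).add
    ((hasDerivAt_mul_L₂_mul_sq (p a c ρ z) s).const_mul (a - c * ρ * z))).congr_deriv ?_
  rw [flux]
  ring

theorem hasDerivAt_flux (z : ℂ) (s : ℝ) :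
    HasDerivAt (fun s : ℝ => flux a c ρ s z) (p a c ρ z / 4 * F a c ρ s z) s := by
  refine (((hasDerivAt_mul_L₂_mul_sq (p a c ρ z) s).const_mul (p a c ρ z / 2)).add
    ((hasDerivAt_L₁_mul_sq (p a c ρ z) s).const_mul ((a - c * ρ * z) / 2))).congr_deriv ?_
  rw [F]
  ring

@[simp]
theorem F_zero_time (z : ℂ) : F a c ρ 0 z = 1 := by simp [F, L₁_zero]

@[simp]
theorem flux_zero_time (z : ℂ) : flux a c ρ 0 z = (a - c * ρ * z) / 2 := by simp [flux, L₁_zero]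

theorem conj_p (z : ℂ) : conj (p a c ρ z) = p a c ρ (conj z) := by simp [p]

theorem conj_F (t : ℝ) (z : ℂ) : conj (F a c ρ t z) = F a c ρ t (conj z) := by
  simp [F, conj_L₁, conj_L₂, conj_p, Complex.conj_ofNat]

theorem conj_flux (t : ℝ) (z : ℂ) : conj (flux a c ρ t z) = flux a c ρ t (conj z) := by
  simp [flux, conj_L₁, conj_L₂, conj_p, Complex.conj_ofNat]

theorem continuous_F : Continuous fun q : ℂ × ℝ => F a c ρ q.2 q.1 := by
  unfold F p
  fun_prop

theorem differentiable_F (t : ℝ) : Differentiable ℂ (F a c ρ t) := by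
  have h1 : Differentiable ℂ fun z => p a c ρ z * t ^ 2 / 4 := by
    unfold p
    fun_prop
  exact (differentiable_L₁.comp h1).add
    ((by fun_prop : Differentiable ℂ fun z : ℂ => (a : ℂ) - c * ρ * z).mul
      ((differentiable_L₂.comp h1).const_mul _))

theorem continuous_F_time (z : ℂ) : Continuous fun s : ℝ => F a c ρ s z :=
  continuous_iff_continuousAt.mpr fun s => (hasDerivAt_F a c ρ z s).continuousAt

theorem continuous_flux_time (z : ℂ) : Continuous fun s : ℝ => flux a c ρ s z :=
  continuous_iff_continuousAt.mpr fun s => (hasDerivAt_flux a c ρ z s).continuousAt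

/-- The Wronskian identity for two spectral parameters. -/
theorem flux_mul_F_sub (t : ℝ) (z w : ℂ) :
    flux a c ρ t z * F a c ρ t w - F a c ρ t z * flux a c ρ t w =
      c * ρ * (w - z) / 2 +
        (p a c ρ z - p a c ρ w) / 4 * ∫ s in (0 : ℝ)..t, F a c ρ s z * F a c ρ s w := by
  have hd : ∀ s ∈ Set.uIcc 0 t,
      HasDerivAt (fun s : ℝ => flux a c ρ s z * F a c ρ s w - F a c ρ s z * flux a c ρ s w)
        ((p a c ρ z - p a c ρ w) / 4 * (F a c ρ s z * F a c ρ s w)) s := fun s _ => by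
    refine (((hasDerivAt_flux a c ρ z s).mul (hasDerivAt_F a c ρ w s)).sub
      ((hasDerivAt_F a c ρ z s).mul (hasDerivAt_flux a c ρ w s))).congr_deriv ?_
    ring
  have h1 := intervalIntegral.integral_eq_sub_of_hasDerivAt hd
    ((((continuous_F_time a c ρ z).mul (continuous_F_time a c ρ w)).const_mul
      _).intervalIntegrable _ _)
  rw [intervalIntegral.integral_const_mul, F_zero_time, F_zero_time, flux_zero_time,
    flux_zero_time] at h1
  rw [h1]
  ring

/-- The energy identity. -/
theorem integral_normSq_flux_add (t : ℝ) (z : ℂ) (hz : F a c ρ t z = 0) :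
    ((∫ s in (0 : ℝ)..t, normSq (flux a c ρ s z) : ℝ) : ℂ) +
      p a c ρ z / 4 * (∫ s in (0 : ℝ)..t, normSq (F a c ρ s z) : ℝ) +
        (a - c * ρ * z) / 2 = 0 := by
  -- By conjugation symmetry, `F a c ρ s (conj z)` is the conjugate of `F a c ρ s z`.
  have hd : ∀ s ∈ Set.uIcc 0 t,
      HasDerivAt (fun s : ℝ => F a c ρ s (conj z) * flux a c ρ s z)
        ((normSq (flux a c ρ s z) : ℂ) + p a c ρ z / 4 * (normSq (F a c ρ s z) : ℂ)) s :=
    fun s _ => by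
    refine ((hasDerivAt_F a c ρ (conj z) s).mul (hasDerivAt_flux a c ρ z s)).congr_deriv ?_
    rw [normSq_eq_conj_mul_self, normSq_eq_conj_mul_self, conj_flux, conj_F]
    ring
  have hc1 : Continuous fun s : ℝ => (normSq (flux a c ρ s z) : ℂ) :=
    continuous_ofReal.comp (continuous_normSq.comp (continuous_flux_time a c ρ z))
  have hc2 : Continuous fun s : ℝ => p a c ρ z / 4 * (normSq (F a c ρ s z) : ℂ) :=
    (continuous_ofReal.comp (continuous_normSq.comp (continuous_F_time a c ρ z))).const_mul _
  have h1 := intervalIntegral.integral_eq_sub_of_hasDerivAt hd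
    ((hc1.add hc2).intervalIntegrable _ _)
  rw [intervalIntegral.integral_add (hc1.intervalIntegrable _ _) (hc2.intervalIntegrable _ _),
    intervalIntegral.integral_const_mul, intervalIntegral.integral_ofReal,
    intervalIntegral.integral_ofReal, F_zero_time, flux_zero_time, ← conj_F, hz] at h1
  rw [h1]
  simp

end

/-! ### Reality and simplicity of the zeros -/

/-- A solution of the quadratic equation given by the energy identity is real, and it is a simple
root. -/
theorem im_eq_zero_of_energy {a c ρ D Y : ℝ} (ha : 0 < a) (hρ : ρ ∈ Set.Icc (-1 : ℝ) 1)
    (hD : 0 ≤ D) (hY : 0 ≤ Y) {z : ℂ}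
    (h : (D : ℂ) + p a c ρ z / 4 * Y + (a - c * ρ * z) / 2 = 0) :
    z.im = 0 ∧
      c * ρ / 2 - ((c ^ 2 - 2 * a * ρ * c) - 2 * c ^ 2 * (1 - ρ ^ 2) * z.re) / 4 * Y ≠ 0 := by
  obtain ⟨u, v⟩ := z
  have hz : (⟨u, v⟩ : ℂ) = u + v * I := by apply Complex.ext <;> simp
  have h1 : ((D + (a ^ 2 + (c ^ 2 - 2 * a * ρ * c) * u - c ^ 2 * (1 - ρ ^ 2) * (u ^ 2 - v ^ 2)) / 4
      * Y + (a - c * ρ * u) / 2 : ℝ) : ℂ) + ((v * (((c ^ 2 - 2 * a * ρ * c)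
      - 2 * c ^ 2 * (1 - ρ ^ 2) * u) / 4 * Y - c * ρ / 2) : ℝ) : ℂ) * I = 0 := by
    rw [← h, hz, p]
    push_cast
    linear_combination (c ^ 2 * (1 - ρ ^ 2) * v ^ 2 * Y / 4 : ℂ) * I_sq
  have hre := congrArg re h1
  have him := congrArg im h1
  simp only [add_re, add_im, ofReal_re, ofReal_im, re_ofReal_mul, im_ofReal_mul, I_re, I_im,
    mul_zero, mul_one, add_zero, zero_add, zero_re, zero_im] at hre him
  have hκ : 0 ≤ c ^ 2 * (1 - ρ ^ 2) * Y / 4 := by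
    have : 0 ≤ 1 - ρ ^ 2 := by nlinarith [hρ.1, hρ.2]
    positivity
  have hslope : ((c ^ 2 - 2 * a * ρ * c) - 2 * c ^ 2 * (1 - ρ ^ 2) * u) / 4 * Y - c * ρ / 2 ≠ 0 := by
    intro h0
    have h2 : D + a / 2 + a ^ 2 * Y / 4 + c ^ 2 * (1 - ρ ^ 2) * Y / 4 * (u ^ 2 + v ^ 2) = 0 := by
      linear_combination hre - u * h0
    -- In `h2` all terms are nonnegative and `a / 2` is positive, a contradiction.
    have h3 := mul_nonneg hκ (by positivity : 0 ≤ u ^ 2 + v ^ 2)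
    have h4 : 0 ≤ a ^ 2 * Y / 4 := by positivity
    linarith
  refine ⟨(mul_eq_zero.mp him).resolve_right hslope, fun h0 => hslope ?_⟩
  simp only at h0
  linarith

/-- The zeros of `F` are real and simple. -/
theorem im_eq_zero_and_deriv_ne_zero {a c ρ t : ℝ} (ha : 0 < a) (hρ : ρ ∈ Set.Icc (-1 : ℝ) 1)
    (ht : 0 < t) {z : ℂ} (hz : F a c ρ t z = 0) : z.im = 0 ∧ deriv (F a c ρ t) z ≠ 0 := by
  have hY := intervalIntegral.integral_nonneg (μ := MeasureTheory.volume) ht.le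
    fun s _ => normSq_nonneg (F a c ρ s z)
  have hD := intervalIntegral.integral_nonneg (μ := MeasureTheory.volume) ht.le
    fun s _ => normSq_nonneg (flux a c ρ s z)
  obtain ⟨him, hslope⟩ := im_eq_zero_of_energy ha hρ hD hY (integral_normSq_flux_add a c ρ t z hz)
  refine ⟨him, fun hd => hslope ?_⟩
  have hconj : conj z = z := Complex.conj_eq_iff_im.mpr him
  have hzre : ((z.re : ℝ) : ℂ) = z := Complex.conj_eq_iff_re.mp hconj
  -- The Wronskian divided by `w - z`; continuity of `Φ` alone makes `Φ z` the derivative of the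
  -- Wronskian at `z`.
  set Φ : ℂ → ℂ := fun w => c * ρ / 2 - ((c ^ 2 - 2 * a * ρ * c) - c ^ 2 * (1 - ρ ^ 2) * (z + w)) / 4
    * ∫ s in (0 : ℝ)..t, F a c ρ s z * F a c ρ s w with hΦ
  have hΦc : Continuous Φ := by
    have h1 : Continuous fun w : ℂ => ∫ s in (0 : ℝ)..t, F a c ρ s z * F a c ρ s w := by
      refine intervalIntegral.continuous_parametric_intervalIntegral_of_continuous' ?_ 0 t
      exact ((continuous_F_time a c ρ z).comp continuous_snd).mul (continuous_F a c ρ)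
    fun_prop
  have hfac : ∀ w, flux a c ρ t z * F a c ρ t w = (w - z) * Φ w := by
    intro w
    have h1 := flux_mul_F_sub a c ρ t z w
    rw [hz, zero_mul, sub_zero] at h1
    rw [h1, hΦ]
    simp only [p]
    ring
  have hderiv : HasDerivAt (fun w => (w - z) * Φ w) (Φ z) z := by
    rw [hasDerivAt_iff_tendsto_slope]
    refine (hΦc.continuousAt.mono_left nhdsWithin_le_nhds : Tendsto Φ (𝓝[≠] z) (𝓝 (Φ z))).congr' ?_
    filter_upwards [self_mem_nhdsWithin] with w hw
    have : w - z ≠ 0 := sub_ne_zero.mpr hw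
    simp [slope_def_field, this]
  have h2 : HasDerivAt (fun w => flux a c ρ t z * F a c ρ t w) (flux a c ρ t z * 0) z :=
    hd ▸ ((differentiable_F a c ρ t z).hasDerivAt.const_mul _)
  have h3 : Φ z = 0 := by
    rw [funext hfac, mul_zero] at h2
    exact hderiv.unique h2
  -- For real `z`, `F` is real, so `Φ z` is exactly the slope excluded by the energy identity.
  have h4 : ∫ s in (0 : ℝ)..t, F a c ρ s z * F a c ρ s z =
      ((∫ s in (0 : ℝ)..t, normSq (F a c ρ s z) : ℝ) : ℂ) := by
    rw [← intervalIntegral.integral_ofReal]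
    congr 1
    ext s
    rw [normSq_eq_conj_mul_self, conj_F, hconj]
  simp only [hΦ] at h3
  rw [h4] at h3
  apply Complex.ofReal_injective
  rw [ofReal_zero, ← h3]
  push_cast
  rw [hzre]
  ring

/-! ### Growth of `F` and infinitude of its zeros -/

/-- `F` is of exponential type. -/
theorem norm_F_le {a c ρ t : ℝ} (ha : 0 < a) (hc : 0 < c) (hρ : ρ ∈ Set.Icc (-1 : ℝ) 1)
    (ht : 0 < t) (z : ℂ) : ‖F a c ρ t z‖ ≤ Real.exp (2 * (a + c) * t * (1 + ‖z‖)) := by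
  set r : ℝ := (a + c) * t * (1 + ‖z‖) with hr
  have hz0 := norm_nonneg z
  have hr0 : 0 ≤ r := by positivity
  have hlin : ‖(a : ℂ) - c * ρ * z‖ ≤ (a + c) * (1 + ‖z‖) := by
    have hρ1 : |ρ| ≤ 1 := abs_le.mpr hρ
    calc ‖(a : ℂ) - c * ρ * z‖ ≤ ‖(a : ℂ)‖ + ‖(c : ℂ) * ρ * z‖ := norm_sub_le _ _
      _ = a + c * |ρ| * ‖z‖ := by
        simp [abs_of_pos ha, abs_of_pos hc]
      _ ≤ a + c * 1 * ‖z‖ := by gcongr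
      _ ≤ (a + c) * (1 + ‖z‖) := by nlinarith
  have hp : ‖p a c ρ z‖ ≤ 2 * ((a + c) * (1 + ‖z‖)) ^ 2 := by
    calc ‖p a c ρ z‖ ≤ ‖((a : ℂ) - ρ * c * z) ^ 2‖ + ‖(c : ℂ) ^ 2 * (z - z ^ 2)‖ := norm_add_le _ _
      _ ≤ ((a + c) * (1 + ‖z‖)) ^ 2 + c ^ 2 * (‖z‖ + ‖z‖ ^ 2) := by
        refine add_le_add ?_ ?_
        · rw [norm_pow, mul_comm (ρ : ℂ)]
          gcongr
        · rw [norm_mul, norm_pow, norm_real, Real.norm_eq_abs, sq_abs, ← norm_pow]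
          gcongr
          exact norm_sub_le _ _
      _ ≤ 2 * ((a + c) * (1 + ‖z‖)) ^ 2 := by
        have h1 : c ^ 2 * (‖z‖ + ‖z‖ ^ 2) ≤ (a + c) ^ 2 * (1 + ‖z‖) ^ 2 := by
          gcongr
          · linarith
          · nlinarith
        linarith [mul_pow (a + c) (1 + ‖z‖) 2]
  have harg : ‖p a c ρ z * t ^ 2 / 4‖ ≤ r ^ 2 := by
    have h1 : ‖p a c ρ z * t ^ 2 / 4‖ = ‖p a c ρ z‖ * t ^ 2 / 4 := by simp
    rw [h1]
    calc ‖p a c ρ z‖ * t ^ 2 / 4 ≤ 2 * ((a + c) * (1 + ‖z‖)) ^ 2 * t ^ 2 / 4 := by gcongr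
      _ = r ^ 2 / 2 := by rw [hr]; ring
      _ ≤ r ^ 2 := by linarith [sq_nonneg r]
  have h₁ : ‖L₁ (p a c ρ z * t ^ 2 / 4)‖ ≤ Real.exp r :=
    norm_tsum_pow_div_factorial_le (φ := fun n => 2 * n) (fun _ => le_rfl) hr0 harg
  have h₂ : ‖L₂ (p a c ρ z * t ^ 2 / 4)‖ ≤ Real.exp r :=
    norm_tsum_pow_div_factorial_le (φ := fun n => 2 * n + 1) (fun _ => Nat.le_succ _) hr0 harg
  calc ‖F a c ρ t z‖
      ≤ Real.exp r + (a + c) * (1 + ‖z‖) * (t / 2 * Real.exp r) := by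
        refine (norm_add_le _ _).trans (add_le_add h₁ ?_)
        rw [norm_mul, norm_mul, norm_div, norm_real, norm_ofNat, Real.norm_eq_abs, abs_of_pos ht]
        gcongr
    _ = Real.exp r * (r / 2 + 1) := by rw [hr]; ring
    _ ≤ Real.exp r * Real.exp r := by
      gcongr
      linarith [Real.add_one_le_exp r]
    _ = _ := by rw [← Real.exp_add, hr]; congr 1; ring

theorem F_zero (a c ρ t : ℝ) (ha : 0 < a) : F a c ρ t 0 = exp (a * t / 2) := by
  have ha' : (a : ℂ) ≠ 0 := by exact_mod_cast ha.ne'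
  rw [F_eq a c ρ t 0 a (by simp [p]) ha', ← cosh_add_sinh]
  simp only [mul_zero, sub_zero]
  field_simp

/-- At real points where `√p(z) t / 2 = k π i` with `k ≥ 1`, one has `F = (-1) ^ k`. -/
theorem F_eq_neg_one_pow {a c ρ t : ℝ} (ht : 0 < t) {x : ℝ} {k : ℕ} (hk : k ≠ 0)
    (hx : (a - ρ * c * x) ^ 2 + c ^ 2 * (x - x ^ 2) = -(2 * Real.pi * k / t) ^ 2) :
    F a c ρ t x = (-1) ^ k := by
  have ht' : (t : ℂ) ≠ 0 := by exact_mod_cast ht.ne'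
  have hk' : (k : ℂ) ≠ 0 := by exact_mod_cast hk
  have hpi : (Real.pi : ℂ) ≠ 0 := by exact_mod_cast Real.pi_ne_zero
  have hP : (2 * Real.pi * k / t * I : ℂ) ^ 2 = p a c ρ x := by
    have h1 : p a c ρ x = ((-(2 * Real.pi * k / t) ^ 2 : ℝ) : ℂ) := by
      rw [← hx, p]
      push_cast
      ring
    rw [h1, mul_pow, I_sq]
    push_cast
    ring
  have harg : (2 * Real.pi * k / t * I : ℂ) * t / 2 = k * Real.pi * I := by
    field_simp
  have hcos : cos ((k : ℂ) * Real.pi) = (-1) ^ k := by exact_mod_cast Real.cos_nat_mul_pi k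
  rw [F_eq a c ρ t x _ hP (by simp [ht', hk', hpi]), harg, cosh_mul_I, sinh_mul_I,
    Complex.sin_nat_mul_pi, hcos]
  simp

/-- In one of the two real directions `-p` tends to infinity. -/
theorem exists_tendsto_neg_p {a c ρ : ℝ} (hc : 0 < c) (hρ : ρ ∈ Set.Icc (-1 : ℝ) 1) (ha : 0 < a)
    (hdeg : ¬ (ρ = 1 ∧ c = 2 * a)) : ∃ σ : ℝ, |σ| = 1 ∧
      Tendsto (fun x : ℝ => -((a - ρ * c * (σ * x)) ^ 2 + c ^ 2 * (σ * x - (σ * x) ^ 2)))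
        atTop atTop := by
  -- If `|ρ| < 1` the quadratic term of `-p` wins; if `|ρ| = 1`, `p` is affine, and it is constant
  -- only in the excluded case.
  have key : ∃ σ : ℝ, |σ| = 1 ∧ (0 < 1 - ρ ^ 2 ∨ (1 - ρ ^ 2 = 0 ∧
      0 < (2 * a * ρ * c - c ^ 2) * σ)) := by
    have h1 : 0 ≤ 1 - ρ ^ 2 := by nlinarith [hρ.1, hρ.2]
    rcases h1.lt_or_eq with h | h
    · exact ⟨1, by simp, Or.inl h⟩
    · have h2 : 2 * a * ρ * c - c ^ 2 ≠ 0 := by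
        intro h0
        have h3 : c = 2 * a * ρ := by
          have : c * (2 * a * ρ - c) = 0 := by linarith
          linarith [(mul_eq_zero.mp this).resolve_left hc.ne']
        have h4 : (ρ - 1) * (ρ + 1) = 0 := by linarith
        rcases mul_eq_zero.mp h4 with h5 | h5
        · have : ρ = 1 := by linarith
          exact hdeg ⟨this, by rw [h3, this]; ring⟩
        · have : ρ = -1 := by linarith
          rw [this] at h3
          linarith
      rcases h2.lt_or_gt with h3 | h3
      · exact ⟨-1, by simp, Or.inr ⟨h.symm, by linarith⟩⟩
      · exact ⟨1, by simp, Or.inr ⟨h.symm, by linarith⟩⟩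
  obtain ⟨σ, hσ, h⟩ := key
  have hσ2 : σ ^ 2 = 1 := by rw [← sq_abs, hσ, one_pow]
  refine ⟨σ, hσ, ?_⟩
  have hfun : (fun x : ℝ => -((a - ρ * c * (σ * x)) ^ 2 + c ^ 2 * (σ * x - (σ * x) ^ 2))) =
      fun x => x * (c ^ 2 * (1 - ρ ^ 2) * x + (2 * a * ρ * c - c ^ 2) * σ) + -a ^ 2 := by
    ext x
    linear_combination c ^ 2 * (1 - ρ ^ 2) * x ^ 2 * hσ2
  rw [hfun]
  refine tendsto_atTop_add_const_right _ _ ?_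
  rcases h with h | ⟨h, h'⟩
  · exact tendsto_id.atTop_mul_atTop₀ (tendsto_atTop_add_const_right _ _
      (tendsto_id.const_mul_atTop (by positivity)))
  · simp only [h, mul_zero, zero_mul, zero_add]
    exact tendsto_id.atTop_mul_const h'

theorem infinite_zeros {a c ρ t : ℝ} (ha : 0 < a) (hc : 0 < c) (hρ : ρ ∈ Set.Icc (-1 : ℝ) 1)
    (ht : 0 < t) (hdeg : ¬ (ρ = 1 ∧ c = 2 * a)) : {z : ℂ | F a c ρ t z = 0}.Infinite := by
  intro hfin
  obtain ⟨B, hB⟩ := hfin.isBounded.exists_norm_le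
  obtain ⟨σ, hσ, hlim⟩ := exists_tendsto_neg_p hc hρ ha hdeg
  set q : ℝ → ℝ := fun x => -((a - ρ * c * (σ * x)) ^ 2 + c ^ 2 * (σ * x - (σ * x) ^ 2)) with hq
  have hqc : Continuous q := by fun_prop
  set R : ℝ := |B| + 1 with hR
  have hR0 : 0 < R := by positivity
  have hsurj : ∀ y, q R ≤ y → ∃ x, R ≤ x ∧ q x = y := by
    intro y hy
    obtain ⟨x₁, hx₁, hyx₁⟩ := (hlim.eventually_ge_atTop y).exists_forall_of_atTop.imp
      fun b hb => (⟨le_max_left b R, hb _ (le_max_left b R)⟩ : b ≤ max b R ∧ y ≤ q (max b R))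
    obtain ⟨x, hx, hxy⟩ := intermediate_value_Icc (le_max_right x₁ R) hqc.continuousOn ⟨hy, hyx₁⟩
    exact ⟨x, hx.1, hxy⟩
  have hval : ∀ k : ℕ, k ≠ 0 → q R ≤ (2 * Real.pi * k / t) ^ 2 →
      ∃ x, R ≤ x ∧ F a c ρ t ((σ * x : ℝ) : ℂ) = (-1) ^ k := by
    intro k hk hkR
    obtain ⟨x, hx, hxy⟩ := hsurj _ hkR
    refine ⟨x, hx, F_eq_neg_one_pow ht hk ?_⟩
    rw [← hxy, hq]
    ring
  obtain ⟨N, hN⟩ : ∃ N : ℕ, ∀ k ≥ N, q R ≤ (2 * Real.pi * k / t) ^ 2 := by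
    have h1 : Tendsto (fun k : ℕ => (2 * Real.pi * k / t) ^ 2) atTop atTop := by
      refine (tendsto_pow_atTop two_ne_zero).comp ?_
      exact (tendsto_natCast_atTop_atTop.const_mul_atTop (by positivity)).atTop_div_const ht
    exact (h1.eventually_ge_atTop (q R)).exists_forall_of_atTop
  -- Consecutive `k` give the values `1` and `-1` beyond the supposed bound on the zeros.
  obtain ⟨x, hx, hFx⟩ := hval (2 * (N + 1)) (by omega) (hN _ (by omega))
  obtain ⟨y, hy, hFy⟩ := hval (2 * (N + 1) + 1) (by omega) (hN _ (by omega))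
  rw [pow_mul, neg_one_sq, one_pow] at hFx
  rw [pow_succ, pow_mul, neg_one_sq, one_pow, one_mul] at hFy
  set G : ℝ → ℝ := fun x => (F a c ρ t ((σ * x : ℝ) : ℂ)).re with hG
  have hGc : Continuous G :=
    continuous_re.comp ((differentiable_F a c ρ t).continuous.comp (by fun_prop))
  have hmem : (0 : ℝ) ∈ G '' Set.Ici R := by
    refine isPreconnected_Ici.intermediate_value (f := G) (Set.mem_Ici.mpr hy) (Set.mem_Ici.mpr hx)
      hGc.continuousOn ⟨?_, ?_⟩
    · simp only [hG, hFy, neg_re, one_re]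
      norm_num
    · simp only [hG, hFx, one_re]
      norm_num
  obtain ⟨w, hw, hGw⟩ := hmem
  have him : (F a c ρ t ((σ * w : ℝ) : ℂ)).im = 0 := by
    rw [← Complex.conj_eq_iff_im, conj_F, conj_ofReal]
  have h1 := hB _ (show F a c ρ t ((σ * w : ℝ) : ℂ) = 0 from Complex.ext hGw him)
  rw [norm_real, Real.norm_eq_abs, abs_mul, hσ, one_mul] at h1
  rw [Set.mem_Ici] at hw
  linarith [le_abs_self w, le_abs_self B]

/-- Conjugation symmetry of `F`; this makes `ν` real. -/
theorem logDeriv_F_zero_re (a c ρ t : ℝ) :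
    (((logDeriv (F a c ρ t) 0).re : ℝ) : ℂ) = logDeriv (F a c ρ t) 0 := by
  have hconj : conj ∘ F a c ρ t ∘ conj = F a c ρ t := by
    ext z
    simp [conj_F]
  have h1 : conj (deriv (F a c ρ t) 0) = deriv (F a c ρ t) 0 := by
    have h2 := congrFun (deriv_conj_conj (f := F a c ρ t)) 0
    rw [hconj] at h2
    simpa using h2.symm
  rw [← Complex.conj_eq_iff_re, logDeriv_apply, map_div₀, h1, conj_F, map_zero]

theorem exists_enumeration {a c ρ t : ℝ} (ha : 0 < a) (hc : 0 < c) (hρ : ρ ∈ Set.Icc (-1 : ℝ) 1)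
    (ht : 0 < t) (hdeg : ¬ (ρ = 1 ∧ c = 2 * a)) :
    ∃ α : ℕ → ℂ, Function.Injective α ∧ Set.range α = {z : ℂ | F a c ρ t z = 0} := by
  have hcount : {z : ℂ | F a c ρ t z = 0}.Countable := by
    have h1 : {z : ℂ | F a c ρ t z = 0} ⊆
        ⋃ N : ℕ, {z : ℂ | F a c ρ t z = 0 ∧ ‖z‖ ≤ (N : ℝ) + 1} := by
      intro z hz
      obtain ⟨N, hN⟩ := exists_nat_ge ‖z‖
      exact Set.mem_iUnion.mpr ⟨N, hz, by linarith⟩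
    refine (Set.countable_iUnion fun N => Set.Finite.countable ?_).mono h1
    exact finite_zeros_norm_le (differentiable_F a c ρ t)
      (by rw [F_zero _ _ _ _ ha]; exact exp_ne_zero _) (norm_F_le ha hc hρ ht) (by positivity)
  obtain ⟨hden⟩ := Set.countable_infinite_iff_nonempty_denumerable.mp
    ⟨hcount, infinite_zeros ha hc hρ ht hdeg⟩
  refine ⟨fun n => ((Denumerable.eqv {z : ℂ | F a c ρ t z = 0}).symm n : ℂ),
    Subtype.val_injective.comp (Equiv.injective _), ?_⟩
  rw [show (fun n => ((Denumerable.eqv {z : ℂ | F a c ρ t z = 0}).symm n : ℂ)) =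
    Subtype.val ∘ (Denumerable.eqv {z : ℂ | F a c ρ t z = 0}).symm from rfl,
    (Equiv.surjective _).range_comp, Subtype.range_coe]

end Heston

theorem theorem5p2 (a c ρ t : ℝ) (ha : 0 < a) (hc : 0 < c) (hρ : ρ ∈ Set.Icc (-1 : ℝ) 1)
    (ht : 0 < t) (hdeg : ¬ (ρ = 1 ∧ c = 2 * a)) :
    (∀ z : ℂ, Heston.F a c ρ t z = 0 → z.im = 0 ∧ deriv (Heston.F a c ρ t) z ≠ 0) ∧
    (∃ α : ℕ → ℂ, Function.Injective α ∧ Set.range α = {z : ℂ | Heston.F a c ρ t z = 0}) ∧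
    ∃ ν : ℝ, ∀ α : ℕ → ℂ, Function.Injective α →
      Set.range α = {z : ℂ | Heston.F a c ρ t z = 0} →
      Summable (fun n => 1 / ‖α n‖ ^ 2) ∧
      ∀ z : ℂ, Multipliable (fun n => (1 - z / α n) * Complex.exp (z / α n)) ∧
        Heston.F a c ρ t z = Complex.exp (a * t / 2) * Complex.exp (ν * z) *
          ∏' n, (1 - z / α n) * Complex.exp (z / α n) := by
  have hd := Heston.differentiable_F a c ρ t
  have h0 := Heston.F_zero a c ρ t ha
  have h0' : Heston.F a c ρ t 0 ≠ 0 := h0 ▸ Complex.exp_ne_zero _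
  have hC : 0 ≤ 2 * (a + c) * t := by positivity
  have hbd := Heston.norm_F_le ha hc hρ ht
  refine ⟨fun z hz => Heston.im_eq_zero_and_deriv_ne_zero ha hρ ht hz,
    Heston.exists_enumeration ha hc hρ ht hdeg, (logDeriv (Heston.F a c ρ t) 0).re,
    fun α hα hrange => ?_⟩
  have hz : ∀ n, Heston.F a c ρ t (α n) = 0 := fun n =>
    hrange.subset (Set.mem_range_self n)
  have hs := Heston.summable_one_div_norm_zeros_sq hd h0' hC hbd hα hz
  refine ⟨hs, fun z => ⟨Heston.multipliable_one_sub_mul_exp hs z, ?_⟩⟩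
  rw [Heston.logDeriv_F_zero_re, ← h0]
  exact Heston.eq_exp_mul_tprod hd h0' hC hbd
    (fun z hz => (Heston.im_eq_zero_and_deriv_ne_zero ha hρ ht hz).2) hα hrange z
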